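/- Let $0<\alpha<1$ and $\theta>0$. For every $n\ge 1$ let $(X_1,\dots,X_n)$ be an i.i.d. sample from the exponential distribution with mean $\theta$, with order statistics $X_{1:n}\le\dots\le X_{n:n}$, spacings $U_i=X_{i+1:n}-X_{i:n}$ ($1\le i\le n-1$) and empirical distribution function $\tilde F_n$. Let $$\mathcal E^*_\alpha(\tilde F_n)=\int_0^\infty \tilde F_n(x)\,\bigl[-\mathrm{Ln}_\alpha \tilde F_n(x)\bigr]^{1/\alpha}\,dx,\qquad \mathrm{Ln}_\alpha p=\log p^{\Gamma(1+\alpha)}=\Gamma(1+\alpha)\log p,$$ (the integrand being $0$ where $\tilde F_n(x)=0$) be the empirical extended fractional cumulative past entropy, with the fractional logarithm $\mathrm{Ln}_\alpha$ taken in its logarithmic form. Then, for every $n$, the spacings $U_1,\dots,U_{n-1}$ are independent, $U_i$ is exponentially distributed with rate $(n-i)/\theta$, and almost surely $$\mathcal E^*_\alpha(\tilde F_n)=\Gamma(1+\alpha)^{1/\alpha}\sum_{i=1}^{n-1}U_i\,\frac in\Bigl(-\log\frac in\Bigr)^{1/\alpha};$$ the random variable $\mathcal E^*_\alpha(\tilde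 F_n)$ has a finite second moment and, for $n\ge2$, a positive variance; and $$\frac{\mathcal E^*_\alpha(\tilde F_n)-E[\mathcal E^*_\alpha(\tilde F_n)]}{\sqrt{\mathrm{Var}[\mathcal E^*_\alpha(\tilde F_n)]}}\longrightarrow N(0,1)\quad\text{in distribution as } n\to\infty .$$ -/

import Mathlib

open MeasureTheory ProbabilityTheory Filter

noncomputable section

/-- The order statistics `X_{1:n} ≤ ... ≤ X_{n:n}` of a sample of size `n`
(indexed from `0`). -/
def orderStat {n : ℕ} (x : Fin n → ℝ) : Fin n → ℝ := x ∘ Tuple.sort x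

/-- The sample spacings `U_i = X_{i+1:n} - X_{i:n}`, `i = 1, ..., n - 1`
(here `U_i` has the index `i - 1`). -/
def spacing {n : ℕ} (x : Fin n → ℝ) (i : Fin (n - 1)) : ℝ :=
  orderStat x ⟨i + 1, by omega⟩ - orderStat x ⟨i, by omega⟩

/-- The empirical distribution function of a sample of size `n`. -/
def empCDF {n : ℕ} (x : Fin n → ℝ) (t : ℝ) : ℝ :=
  ((Finset.univ.filter fun j => x j ≤ t).card : ℝ) / n

/-- The fractional logarithm of order `α` in its working form `log (p ^ α!)`,
where `α! = Γ(1 + α)`. -/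
def fracLog (α p : ℝ) : ℝ := Real.log (p ^ Real.Gamma (1 + α))

/-- The extended fractional cumulative past entropy of order `α` of a distribution
function `F`, i.e. the integral over `(0, ∞)` of `F(t) * (-Ln_α F(t)) ^ (1 / α)`.
The integrand is `0` where `F(t) = 0`. -/
def efcpe (α : ℝ) (F : ℝ → ℝ) : ℝ :=
  ∫ t in Set.Ioi (0 : ℝ), F t * (-fracLog α (F t)) ^ (1 / α)

/-- The empirical EFCPE of a sample. -/
def empEFCPE (α : ℝ) {n : ℕ} (x : Fin n → ℝ) : ℝ := efcpe α (empCDF x)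

end

open scoped ENNReal Topology

/-! The empirical distribution function is a step function equal to `i / n` between the `i`-th and
`(i+1)`-st order statistics, so the entropy integral is a fixed linear combination of the spacings
(`empEFCPE_eq_sum_spacing`). By Rényi's representation (`map_gaps_orderStat_pi_expMeasure`) the
spacings of an exponential sample are independent exponentials. The entropy is thus almost surely a
sum of independent terms `c i * U i` with standard deviations `c i / r i`.

Such a sum, standardized, is asymptotically normal once its largest standard deviation is negligible
against the total one: the logarithm of the characteristic function is expanded to second order, and
the cubic error is at most that ratio times `|t| ^ 3`. Here, with `p = i / n`, `c i / r i` is a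
constant times `φ(p) / n`, where `φ(p) = p (-log p) ^ (1/α) / (1 - p)`. As `φ` is bounded on `(0,
1)` and bounded below on `[1/4, 1/2]`, the ratio is `O(n ^ (-1/2))`. -/

/-- The Lebesgue integral of a product of functions of separate coordinates. -/
lemma lintegral_fin_prod_eq_prod {n : ℕ} (μ : Fin n → Measure ℝ) [∀ i, SigmaFinite (μ i)]
    (f : Fin n → ℝ → ℝ≥0∞) (hf : ∀ i, Measurable (f i)) :
    ∫⁻ x, ∏ i, f i (x i) ∂(Measure.pi μ) = ∏ i, ∫⁻ t, f i t ∂(μ i) := by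
  induction n with
  | zero => simp
  | succ n ih =>
    have hmp := (measurePreserving_piFinSuccAbove μ 0).symm
    rw [← hmp.lintegral_comp_emb (MeasurableEquiv.measurableEmbedding _)]
    simp only [MeasurableEquiv.piFinSuccAbove_symm_apply, Fin.insertNthEquiv, Fin.prod_univ_succ,
      Fin.insertNth_zero, Equiv.coe_fn_mk, Fin.cons_succ, Fin.cons_zero]
    simp only [cast_eq]
    rw [lintegral_prod_mul (f := f 0) (g := fun y : Fin n → ℝ => ∏ i, f i.succ (y i))
      (hf 0).aemeasurable]
    · congr 1
      exact ih (fun i => μ i.succ) (fun i => f i.succ) fun i => hf _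
    · exact (Finset.measurable_prod _ fun i _ =>
        (hf _).comp (measurable_pi_apply i)).aemeasurable

/-- A product of measures with densities has the product density. -/
lemma pi_withDensity_eq {n : ℕ} (f : Fin n → ℝ → ℝ≥0∞) (hf : ∀ i, Measurable (f i))
    [∀ i, SigmaFinite (volume.withDensity (f i))] :
    Measure.pi (fun i => (volume : Measure ℝ).withDensity (f i)) =
      (volume : Measure (Fin n → ℝ)).withDensity fun x => ∏ i, f i (x i) := by
  refine Measure.pi_eq fun s hs => ?_
  rw [withDensity_apply _ (MeasurableSet.univ_pi hs), volume_pi, Measure.restrict_pi_pi,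
    lintegral_fin_prod_eq_prod _ f hf]
  exact Finset.prod_congr rfl fun i _ => (withDensity_apply _ (hs i)).symm

/-! ### Order statistics: measurability and integration -/

lemma monotone_orderStat {n : ℕ} (x : Fin n → ℝ) : Monotone (orderStat x) :=
  Tuple.monotone_sort x

lemma card_filter_orderStat_le {n : ℕ} (x : Fin n → ℝ) (t : ℝ) :
    (Finset.univ.filter fun j => orderStat x j ≤ t).card =
      (Finset.univ.filter fun j => x j ≤ t).card := by
  refine Finset.card_equiv (Tuple.sort x) fun i => ?_
  rw [Finset.mem_filter, Finset.mem_filter]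
  simp [orderStat]

/-- With zero-based `j`, both sides say that more than `j` sample points are at most `t`. This gives
measurability of the order statistics and their link with the empirical distribution function. -/
lemma orderStat_le_iff {n : ℕ} (x : Fin n → ℝ) (j : Fin n) (t : ℝ) :
    orderStat x j ≤ t ↔ (j : ℕ) < (Finset.univ.filter fun i => x i ≤ t).card := by
  rw [← card_filter_orderStat_le,
    Tuple.lt_card_le_iff_apply_le_of_monotone (monotone_orderStat x)]

lemma measurable_orderStat (n : ℕ) : Measurable (orderStat : (Fin n → ℝ) → Fin n → ℝ) := by
  refine measurable_pi_lambda _ fun j => measurable_of_Iic fun t => ?_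
  have hcard : Measurable fun x : Fin n → ℝ => (Finset.univ.filter fun i => x i ≤ t).card := by
    simp_rw [Finset.card_filter]
    refine Finset.measurable_fun_sum _ fun i _ => ?_
    exact Measurable.ite (measurableSet_le (measurable_pi_apply i) measurable_const)
      measurable_const measurable_const
  have : (fun x : Fin n → ℝ => orderStat x j) ⁻¹' Set.Iic t =
      {x | (j : ℕ) < (Finset.univ.filter fun i => x i ≤ t).card} := by
    ext x
    exact orderStat_le_iff x j t
  rw [this]
  exact measurableSet_lt measurable_const hcard

lemma measurableSet_monotone_fin (n : ℕ) : MeasurableSet {x : Fin n → ℝ | Monotone x} := by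
  have : {x : Fin n → ℝ | Monotone x} = ⋂ i, ⋂ j, ⋂ (_ : i ≤ j), {x | x i ≤ x j} := by
    ext x
    simp [Monotone]
  rw [this]
  exact MeasurableSet.iInter fun i => MeasurableSet.iInter fun j => MeasurableSet.iInter fun _ =>
    measurableSet_le (measurable_pi_apply i) (measurable_pi_apply j)

/-- Almost every point has pairwise distinct coordinates. -/
lemma ae_injective_volume (n : ℕ) : ∀ᵐ x : Fin n → ℝ, Function.Injective x := by
  have h : ∀ i j : Fin n, i ≠ j → ∀ᵐ x : Fin n → ℝ, x i ≠ x j := by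
    intro i j hij
    -- Ties between two coordinates form a proper subspace, hence a null set.
    let s : Submodule ℝ (Fin n → ℝ) := LinearMap.ker
      (LinearMap.proj (R := ℝ) (φ := fun _ : Fin n => ℝ) i - LinearMap.proj j)
    have hs : s ≠ ⊤ := by
      intro htop
      have : (Pi.single i 1 : Fin n → ℝ) ∈ s := htop ▸ Submodule.mem_top
      simp [s, hij.symm] at this
    rw [ae_iff]
    convert! Measure.addHaar_submodule volume s hs using 2
    ext x
    simp [s, sub_eq_zero]
  have h' : ∀ᵐ x : Fin n → ℝ, ∀ i j : Fin n, i ≠ j → x i ≠ x j := by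
    simp_rw [ae_all_iff]
    exact h
  filter_upwards [h'] with x hx i j hij
  by_contra hne
  exact hx i j hne hij

/-- Integration against the law of the order statistics of an exchangeable diffuse vector. -/
lemma lintegral_orderStat {n : ℕ} (μ : Measure (Fin n → ℝ)) (hμ : μ ≪ volume)
    (hperm : ∀ σ : Equiv.Perm (Fin n), MeasurePreserving (fun x : Fin n → ℝ => x ∘ σ) μ μ)
    {f : (Fin n → ℝ) → ℝ≥0∞} (hf : Measurable f) :
    ∫⁻ x, f (orderStat x) ∂μ =
      n.factorial * ∫⁻ x, Set.indicator {x | Monotone x} f x ∂μ := by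
  have hind : Measurable (Set.indicator {x : Fin n → ℝ | Monotone x} f) :=
    hf.indicator (measurableSet_monotone_fin n)
  -- Without ties, exactly one permutation sorts `x`, so a single term of the sum survives.
  have hsum : ∀ᵐ x ∂μ, f (orderStat x) =
      ∑ σ : Equiv.Perm (Fin n), Set.indicator {x | Monotone x} f (x ∘ σ) := by
    filter_upwards [hμ.ae_le (ae_injective_volume n)] with x hx
    rw [Finset.sum_eq_single (Tuple.sort x)]
    · rw [Set.indicator_of_mem (show x ∘ Tuple.sort x ∈ {x | Monotone x} from
        Tuple.monotone_sort x)]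
      rfl
    · intro σ _ hσ
      refine Set.indicator_of_notMem (fun hmono => hσ ?_) _
      have := Tuple.comp_sort_eq_comp_iff_monotone.2 hmono
      ext i
      exact congrArg Fin.val (hx (congrFun this i))
    · simp
  rw [lintegral_congr_ae hsum, lintegral_finsetSum (f := fun (σ : Equiv.Perm (Fin n)) x =>
    Set.indicator {x | Monotone x} f (x ∘ σ)) _ fun σ _ => hind.comp (hperm σ).measurable]
  have : ∀ σ : Equiv.Perm (Fin n), ∫⁻ x, Set.indicator {x | Monotone x} f (x ∘ σ) ∂μ =
      ∫⁻ x, Set.indicator {x | Monotone x} f x ∂μ := fun σ => (hperm σ).lintegral_comp hind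
  simp [this, Fintype.card_perm]

/-! ### Rényi's representation -/

/-- The consecutive differences of a finite sequence, starting from `0`. -/
noncomputable def gaps {n : ℕ} (x : Fin n → ℝ) (i : Fin n) : ℝ :=
  x i - if h : 0 < (i : ℕ) then x ⟨i - 1, by omega⟩ else 0

/-- The partial sums of a finite sequence. -/
noncomputable def partialSums {n : ℕ} (y : Fin n → ℝ) (i : Fin n) : ℝ := ∑ j ∈ Finset.Iic i, y j

lemma measurable_gaps (n : ℕ) : Measurable (gaps : (Fin n → ℝ) → Fin n → ℝ) := by
  refine measurable_pi_lambda _ fun i => ?_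
  unfold gaps
  split_ifs <;> fun_prop

lemma partialSums_eq_add {n : ℕ} (y : Fin n → ℝ) (i : Fin n) :
    partialSums y i = y i + if h : 0 < (i : ℕ) then partialSums y ⟨i - 1, by omega⟩ else 0 := by
  have hIic : Finset.Iic i = insert i (Finset.Iio i) := by
    ext j
    simp [le_iff_eq_or_lt]
  rw [partialSums, hIic, Finset.sum_insert (by simp)]
  congr 1
  split_ifs with h
  · rw [partialSums]
    refine Finset.sum_congr ?_ fun _ _ => rfl
    ext j
    simp only [Finset.mem_Iio, Finset.mem_Iic, Fin.lt_def, Fin.le_def]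
    omega
  · refine Finset.sum_eq_zero fun j hj => ?_
    simp only [Finset.mem_Iio, Fin.lt_def] at hj
    omega

lemma gaps_partialSums {n : ℕ} (y : Fin n → ℝ) : gaps (partialSums y) = y := by
  ext i
  rw [gaps, partialSums_eq_add y i]
  ring

/-- Identifies sorted nonnegative vectors with the positive orthant, where the exponential product
density lives. -/
lemma monotone_partialSums_iff {n : ℕ} (y : Fin n → ℝ) :
    (Monotone (partialSums y) ∧ ∀ i, 0 ≤ partialSums y i) ↔ ∀ i, 0 ≤ y i := by
  constructor
  · rintro ⟨hmono, hnn⟩ i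
    have h1 := partialSums_eq_add y i
    split_ifs at h1 with h
    · have : partialSums y ⟨i - 1, by omega⟩ ≤ partialSums y i := hmono (by simp [Fin.le_def])
      linarith
    · have := hnn i
      linarith
  · intro hy
    refine ⟨fun i j hij => ?_, fun i => Finset.sum_nonneg fun j _ => hy j⟩
    exact Finset.sum_le_sum_of_subset_of_nonneg (Finset.Iic_subset_Iic.2 hij) fun k _ _ => hy k

/-- `y j` enters the partial sums of index at least `j`, which are `n - j` in number; this is the
source of the rates. -/
lemma sum_partialSums {n : ℕ} (y : Fin n → ℝ) :
    ∑ i, partialSums y i = ∑ i : Fin n, ((n : ℝ) - i) * y i := by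
  unfold partialSums
  rw [Finset.sum_comm' (t' := Finset.univ) (s' := fun j => Finset.Ici j) (by simp)]
  refine Finset.sum_congr rfl fun j _ => ?_
  rw [Finset.sum_const, Fin.card_Ici, nsmul_eq_mul, Nat.cast_sub j.2.le]

/-- The matrix is lower triangular with unit diagonal, so the Jacobian is `1`. -/
lemma measurePreserving_partialSums (n : ℕ) :
    MeasurePreserving (partialSums : (Fin n → ℝ) → Fin n → ℝ) volume volume := by
  let M : Matrix (Fin n) (Fin n) ℝ := Matrix.of fun i j => if j ≤ i then 1 else 0
  have hdet : M.det = 1 := by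
    rw [Matrix.det_of_isLowerTriangular M (fun i j hij => ?_)]
    · simp [M]
    · simp only [M, Matrix.of_apply]
      rw [if_neg]
      simpa using hij
  have hM : (partialSums : (Fin n → ℝ) → Fin n → ℝ) = Matrix.toLin' M := by
    ext y i
    simp [partialSums, Matrix.toLin'_apply, Matrix.mulVec, dotProduct, M, Finset.sum_ite,
      Finset.filter_ge_eq_Iic]
  refine ⟨?_, ?_⟩
  · rw [hM]
    exact (LinearMap.continuous_of_finiteDimensional _).measurable
  · rw [hM, Real.map_matrix_volume_pi_eq_smul_volume_pi (by rw [hdet]; norm_num), hdet]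
    simp

lemma measurable_exponentialPDF (r : ℝ) : Measurable (exponentialPDF r) :=
  (measurable_exponentialPDFReal r).ennreal_ofReal

lemma pi_expMeasure_eq_withDensity {n : ℕ} {r : Fin n → ℝ} (hr : ∀ i, 0 < r i) :
    (Measure.pi fun i => expMeasure (r i)) =
      volume.withDensity fun x : Fin n → ℝ => ∏ i, exponentialPDF (r i) (x i) := by
  have hprob := fun i => isProbabilityMeasure_expMeasure (hr i)
  have : ∀ i, SigmaFinite (volume.withDensity (exponentialPDF (r i))) :=
    fun i => inferInstanceAs (SigmaFinite (expMeasure (r i)))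
  exact pi_withDensity_eq (fun i => exponentialPDF (r i)) fun i => measurable_exponentialPDF _

lemma prod_exponentialPDF {n : ℕ} {r : Fin n → ℝ} (hr : ∀ i, 0 < r i) (x : Fin n → ℝ) :
    ∏ i, exponentialPDF (r i) (x i) =
      Set.indicator {x | ∀ i, 0 ≤ x i}
        (fun x => ENNReal.ofReal ((∏ i, r i) * Real.exp (-∑ i, r i * x i))) x := by
  by_cases hx : ∀ i, 0 ≤ x i
  · rw [Set.indicator_of_mem (show x ∈ {x | ∀ i, 0 ≤ x i} from hx)]
    simp_rw [fun i => exponentialPDF_of_nonneg (r := r i) (hx i)]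
    rw [← ENNReal.ofReal_prod_of_nonneg fun i _ => (mul_pos (hr i) (Real.exp_pos _)).le,
      Finset.prod_mul_distrib, ← Real.exp_sum, Finset.sum_neg_distrib]
  · rw [Set.indicator_of_notMem (show x ∉ {x | ∀ i, 0 ≤ x i} from hx)]
    push Not at hx
    obtain ⟨i, hi⟩ := hx
    exact Finset.prod_eq_zero (Finset.mem_univ i) (exponentialPDF_of_neg hi)

lemma prod_sub_eq_factorial (n : ℕ) : ∏ i : Fin n, ((n : ℝ) - i) = n.factorial := by
  rw [Fin.prod_univ_eq_prod_range (fun i : ℕ => (n : ℝ) - i) n, ← Finset.prod_range_reflect,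
    ← Finset.prod_range_add_one_eq_factorial, Nat.cast_prod]
  refine Finset.prod_congr rfl fun i hi => ?_
  have : i < n := Finset.mem_range.1 hi
  rw [Nat.cast_sub (by omega), Nat.cast_sub (by omega)]
  push_cast
  ring

/-- **Rényi representation**: the gaps between the order statistics of an exponential sample of
rate `r` are independent exponential variables of rates `n * r, (n - 1) * r, ..., r`. -/
theorem map_gaps_orderStat_pi_expMeasure {n : ℕ} {r : ℝ} (hr : 0 < r) :
    (Measure.pi fun _ : Fin n => expMeasure r).map (fun x => gaps (orderStat x)) =
      Measure.pi fun i : Fin n => expMeasure (((n : ℝ) - i) * r) := by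
  have hrate : ∀ i : Fin n, 0 < ((n : ℝ) - i) * r := fun i =>
    mul_pos (sub_pos.2 (by exact_mod_cast i.2)) hr
  have := isProbabilityMeasure_expMeasure hr
  have hprob := fun i : Fin n => isProbabilityMeasure_expMeasure (hrate i)
  have hmeas : Measurable fun x : Fin n → ℝ => gaps (orderStat x) :=
    (measurable_gaps n).comp (measurable_orderStat n)
  have hd : (Measure.pi fun _ : Fin n => expMeasure r) =
      volume.withDensity fun x : Fin n → ℝ => ∏ i, exponentialPDF r (x i) :=
    pi_expMeasure_eq_withDensity fun _ => hr
  have hd' : (Measure.pi fun i : Fin n => expMeasure (((n : ℝ) - i) * r)) =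
      volume.withDensity fun x : Fin n → ℝ =>
        ∏ i : Fin n, exponentialPDF (((n : ℝ) - i) * r) (x i) :=
    pi_expMeasure_eq_withDensity hrate
  have hm : Measurable fun x : Fin n → ℝ => ∏ i, exponentialPDF r (x i) :=
    Finset.measurable_prod _ fun i _ => (measurable_exponentialPDF r).comp (measurable_pi_apply i)
  have hm' : Measurable fun x : Fin n → ℝ =>
      ∏ i : Fin n, exponentialPDF (((n : ℝ) - i) * r) (x i) :=
    Finset.measurable_prod _ fun i _ => (measurable_exponentialPDF _).comp (measurable_pi_apply i)
  refine Measure.ext_of_lintegral _ fun f hf => ?_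
  rw [lintegral_map hf hmeas,
    lintegral_orderStat (f := fun x => f (gaps x)) _ (hd ▸ withDensity_absolutelyContinuous _ _)
      (fun σ => ?_) (hf.comp (measurable_gaps n))]
  · have hg : Measurable (Set.indicator {x : Fin n → ℝ | Monotone x} fun x => f (gaps x)) :=
      (hf.comp (measurable_gaps n)).indicator (measurableSet_monotone_fin n)
    rw [hd, hd', lintegral_withDensity_eq_lintegral_mul _ hm hg,
      lintegral_withDensity_eq_lintegral_mul _ hm' hf,
      ← (measurePreserving_partialSums n).lintegral_comp (hm.mul hg),
      ← lintegral_const_mul' _ _ (ENNReal.natCast_ne_top _)]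
    refine lintegral_congr fun y => ?_
    simp only [Pi.mul_apply]
    rw [prod_exponentialPDF (fun _ => hr), prod_exponentialPDF hrate]
    have hiff := monotone_partialSums_iff y
    by_cases hy : ∀ i, 0 ≤ y i
    · obtain ⟨h1, h2⟩ := hiff.2 hy
      rw [Set.indicator_of_mem (show partialSums y ∈ {x | Monotone x} from h1),
        Set.indicator_of_mem (show partialSums y ∈ {x : Fin n → ℝ | ∀ i, 0 ≤ x i} from h2),
        Set.indicator_of_mem (show y ∈ {x : Fin n → ℝ | ∀ i, 0 ≤ x i} from hy),
        gaps_partialSums, ← mul_assoc, ← ENNReal.ofReal_natCast,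
        ← ENNReal.ofReal_mul (Nat.cast_nonneg _)]
      -- The factor `n!` from the sorting is exactly the product of the `n - i`, the normalizing
      -- constant of the new densities.
      congr 2
      rw [← Finset.mul_sum, sum_partialSums, Finset.prod_mul_distrib, prod_sub_eq_factorial,
        Finset.mul_sum, ← mul_assoc]
      congr 3
      exact Finset.sum_congr rfl fun i _ => by ring
    · rw [Set.indicator_of_notMem (show y ∉ {x : Fin n → ℝ | ∀ i, 0 ≤ x i} from hy), zero_mul]
      by_cases h1 : Monotone (partialSums y)
      · rw [Set.indicator_of_notMem (s := {x : Fin n → ℝ | ∀ i, 0 ≤ x i})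
          (fun h2 => hy (hiff.1 ⟨h1, h2⟩))]
        simp
      · rw [Set.indicator_of_notMem (s := {x : Fin n → ℝ | Monotone x}) h1]
        simp
  · have := measurePreserving_piCongrLeft (fun _ : Fin n => expMeasure r) σ.symm
    convert! this using 1
    ext x i
    simp [MeasurableEquiv.coe_piCongrLeft, Equiv.piCongrLeft_apply]

lemma spacing_eq_gaps {n : ℕ} (x : Fin n → ℝ) (i : Fin (n - 1)) :
    spacing x i = gaps (orderStat x) ⟨i + 1, by omega⟩ := by
  simp [spacing, gaps]

/-! ### Spacings of an exponential sample -/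

section Sample

variable {Ω : Type*} [MeasurableSpace Ω] {P : Measure Ω} {n : ℕ}
  {X : Fin n → Ω → ℝ} {θ : ℝ}

lemma hasLaw_gaps_orderStat (hθ : 0 < θ) (hindep : iIndepFun X P)
    (hlaw : ∀ i, HasLaw (X i) (expMeasure θ⁻¹) P) :
    HasLaw (fun ω => gaps (orderStat fun j => X j ω))
      (Measure.pi fun i : Fin n => expMeasure (((n : ℝ) - i) * θ⁻¹)) P := by
  have h := hindep.hasLaw_pi hlaw
  exact HasLaw.fun_comp (Y := fun x => gaps (orderStat x)) ⟨((measurable_gaps n).comp (measurable_orderStat n)).aemeasurable,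
    map_gaps_orderStat_pi_expMeasure (inv_pos.2 hθ)⟩ h

lemma hasLaw_gaps_orderStat_apply (hθ : 0 < θ) (hindep : iIndepFun X P)
    (hlaw : ∀ i, HasLaw (X i) (expMeasure θ⁻¹) P) (i : Fin n) :
    HasLaw (fun ω => gaps (orderStat fun j => X j ω) i)
      (expMeasure (((n : ℝ) - i) * θ⁻¹)) P := by
  have hprob := fun i : Fin n => isProbabilityMeasure_expMeasure
    (mul_pos (sub_pos.2 (by exact_mod_cast i.2 : (i : ℝ) < n)) (inv_pos.2 hθ))
  exact (measurePreserving_eval _ i).fun_comp_hasLaw (hasLaw_gaps_orderStat hθ hindep hlaw)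

/-- The law of the spacings of an exponential sample. -/
theorem hasLaw_spacing (hθ : 0 < θ) (hindep : iIndepFun X P)
    (hlaw : ∀ i, HasLaw (X i) (expMeasure θ⁻¹) P) (i : Fin (n - 1)) :
    HasLaw (fun ω => spacing (fun j => X j ω) i)
      (expMeasure (((n : ℝ) - ((i : ℝ) + 1)) / θ)) P := by
  simp_rw [spacing_eq_gaps]
  convert! hasLaw_gaps_orderStat_apply hθ hindep hlaw ⟨i + 1, by omega⟩ using 2
  push_cast
  rfl

/-- The spacings of an exponential sample are independent. -/
theorem iIndepFun_spacing [IsProbabilityMeasure P] (hθ : 0 < θ) (hindep : iIndepFun X P)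
    (hlaw : ∀ i, HasLaw (X i) (expMeasure θ⁻¹) P) :
    iIndepFun (fun i ω => spacing (fun j => X j ω) i) P := by
  have h : iIndepFun (fun i ω => gaps (orderStat fun j => X j ω) i) P :=
    (iIndepFun_iff_hasLaw_pi_pi (hasLaw_gaps_orderStat_apply hθ hindep hlaw)).2
      (hasLaw_gaps_orderStat hθ hindep hlaw)
  simp_rw [spacing_eq_gaps]
  refine h.precomp (g := fun i : Fin (n - 1) => (⟨i + 1, by omega⟩ : Fin n)) fun i j hij => ?_
  simpa [Fin.ext_iff] using hij

end Sample

/-! ### The empirical entropy as a weighted sum of spacings -/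

/-- A function of the empirical distribution function that vanishes at `0` and `1` is a step
function on the intervals between consecutive order statistics. -/
lemma comp_empCDF_eq_sum_indicator {n : ℕ} (x : Fin n → ℝ) {h : ℝ → ℝ} (h0 : h 0 = 0)
    (h1 : h 1 = 0) (t : ℝ) :
    h (empCDF x t) = ∑ i : Fin (n - 1), Set.indicator
      (Set.Ico (orderStat x ⟨i, by omega⟩) (orderStat x ⟨i + 1, by omega⟩))
      (fun _ => h (((i : ℝ) + 1) / n)) t := by
  have hmem : ∀ i : Fin (n - 1),
      t ∈ Set.Ico (orderStat x ⟨i, by omega⟩) (orderStat x ⟨i + 1, by omega⟩) ↔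
        (Finset.univ.filter fun j => x j ≤ t).card = (i : ℕ) + 1 := by
    intro i
    rw [Set.mem_Ico, ← not_le (a := orderStat x ⟨i + 1, by omega⟩), orderStat_le_iff,
      orderStat_le_iff]
    dsimp only
    omega
  have hle : (Finset.univ.filter fun j => x j ≤ t).card ≤ n := by
    simpa using Finset.card_filter_le Finset.univ fun j => x j ≤ t
  rw [empCDF]
  generalize (Finset.univ.filter fun j => x j ≤ t).card = k at hmem hle
  -- The counts `0` and `n` belong to the two unbounded pieces, where `h` vanishes.
  by_cases hk : 1 ≤ k ∧ k < n
  · rw [Finset.sum_eq_single (⟨k - 1, by omega⟩ : Fin (n - 1))]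
    · rw [Set.indicator_of_mem ((hmem _).2 (by dsimp only; omega))]
      dsimp only
      rw [Nat.cast_sub hk.1]
      norm_num
    · intro i _ hi
      refine Set.indicator_of_notMem (fun hti => hi ?_) _
      have := (hmem i).1 hti
      ext
      dsimp only
      omega
    · simp
  · rw [Finset.sum_eq_zero fun i _ => Set.indicator_of_notMem (fun hti => ?_) _]
    · rcases Nat.eq_zero_or_pos k with rfl | hpos
      · simpa using h0
      · have hkn : k = n := by omega
        rw [hkn, div_self (by exact_mod_cast (by omega : n ≠ 0)), h1]
    · have := (hmem i).1 hti
      omega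

/-- The integral over `(0, ∞)` of a function of the empirical distribution function of a
nonnegative sample. -/
lemma setIntegral_comp_empCDF {n : ℕ} (x : Fin n → ℝ) (hx : ∀ i, 0 ≤ x i) {h : ℝ → ℝ}
    (h0 : h 0 = 0) (h1 : h 1 = 0) :
    ∫ t in Set.Ioi (0 : ℝ), h (empCDF x t) =
      ∑ i : Fin (n - 1), spacing x i * h (((i : ℝ) + 1) / n) := by
  simp_rw [comp_empCDF_eq_sum_indicator x h0 h1]
  rw [← integral_Ici_eq_integral_Ioi, integral_finsetSum]
  · refine Finset.sum_congr rfl fun i _ => ?_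
    have hsub : Set.Ico (orderStat x ⟨i, by omega⟩) (orderStat x ⟨i + 1, by omega⟩) ⊆
        Set.Ici (0 : ℝ) := fun t ht => (hx _).trans ht.1
    rw [setIntegral_indicator measurableSet_Ico, Set.inter_eq_self_of_subset_right hsub,
      setIntegral_const, Real.volume_real_Ico_of_le
        (monotone_orderStat x (by simp [Fin.le_def])), smul_eq_mul, spacing]
  · intro i _
    refine (IntegrableOn.integrable_indicator ?_ measurableSet_Ico).integrableOn
    exact integrableOn_const (by simp)

lemma mul_neg_fracLog_rpow (α : ℝ) (hα : 0 < α) {p : ℝ} (hp0 : 0 < p) (hp1 : p ≤ 1) :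
    p * (-fracLog α p) ^ (1 / α) =
      Real.Gamma (1 + α) ^ (1 / α) * (p * (-Real.log p) ^ (1 / α)) := by
  rw [fracLog, Real.log_rpow hp0, ← mul_neg,
    Real.mul_rpow (Real.Gamma_pos_of_pos (by linarith)).le
      (neg_nonneg.2 (Real.log_nonpos hp0.le hp1))]
  ring

/-- The empirical extended fractional cumulative past entropy of a nonnegative sample is a weighted
sum of the spacings. -/
theorem empEFCPE_eq_sum_spacing {α : ℝ} (hα : 0 < α) {n : ℕ} (x : Fin n → ℝ)
    (hx : ∀ i, 0 ≤ x i) :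
    empEFCPE α x = Real.Gamma (1 + α) ^ (1 / α) * ∑ i : Fin (n - 1), spacing x i *
        ((((i : ℝ) + 1) / n) * (-Real.log (((i : ℝ) + 1) / n)) ^ (1 / α)) := by
  have hα' : 1 / α ≠ 0 := (one_div_pos.2 hα).ne'
  rw [empEFCPE, efcpe, setIntegral_comp_empCDF x hx (h := fun p => p * (-fracLog α p) ^ (1 / α))
    (by simp) (by simp [fracLog, Real.zero_rpow hα', -one_div]), Finset.mul_sum]
  refine Finset.sum_congr rfl fun i _ => ?_
  have hin := i.2
  have hn : 0 < (n : ℝ) := by exact_mod_cast (by omega : 0 < n)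
  have hi : (i : ℝ) + 1 ≤ n := by exact_mod_cast (by omega : (i : ℕ) + 1 ≤ n)
  rw [mul_neg_fracLog_rpow α hα (by positivity) ((div_le_one hn).2 hi)]
  ring

/-! ### Moments and characteristic function of the exponential law -/

lemma ae_nonneg_of_hasLaw_expMeasure {Ω : Type*} [MeasurableSpace Ω] {P : Measure Ω} {X : Ω → ℝ}
    {r : ℝ} (hX : HasLaw X (expMeasure r) P) : ∀ᵐ ω ∂P, 0 ≤ X ω := by
  rw [hX.ae_iff (p := fun x => 0 ≤ x) (measurableSet_setOfPred.1 measurableSet_Ici), ae_iff]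
  have : {x : ℝ | ¬0 ≤ x} = Set.Iio 0 := by
    ext
    simp
  rw [this, expMeasure, gammaMeasure, withDensity_apply _ measurableSet_Iio]
  exact lintegral_gammaPDF_of_nonpos le_rfl

lemma integral_expMeasure {E : Type*} [NormedAddCommGroup E] [NormedSpace ℝ E] {r : ℝ} (hr : 0 < r)
    (f : ℝ → E) :
    ∫ x, f x ∂(expMeasure r) = ∫ x in Set.Ioi (0 : ℝ), (r * Real.exp (-(r * x))) • f x := by
  have hd : expMeasure r = volume.withDensity (exponentialPDF r) := rfl
  rw [hd, integral_withDensity_eq_integral_toReal_smul (measurable_exponentialPDF r)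
    (ae_of_all _ fun _ => ENNReal.ofReal_lt_top), ← integral_Ici_eq_integral_Ioi,
    ← integral_indicator measurableSet_Ici]
  congr 1
  ext x
  by_cases hx : 0 ≤ x
  · rw [Set.indicator_of_mem (Set.mem_Ici.2 hx), exponentialPDF_of_nonneg hx,
      ENNReal.toReal_ofReal (by positivity)]
  · rw [Set.indicator_of_notMem (by simpa using hx), exponentialPDF_of_neg (not_le.1 hx)]
    simp

lemma integral_pow_expMeasure {r : ℝ} (hr : 0 < r) (k : ℕ) :
    ∫ x, x ^ k ∂(expMeasure r) = k.factorial / r ^ k := by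
  rw [integral_expMeasure hr]
  have h := Real.integral_rpow_mul_exp_neg_mul_Ioi (a := (k : ℝ) + 1) (by positivity) hr
  rw [Real.Gamma_nat_eq_factorial, add_sub_cancel_right] at h
  simp_rw [Real.rpow_natCast] at h
  have : ∀ x : ℝ, (r * Real.exp (-(r * x))) • x ^ k = r * (x ^ k * Real.exp (-(r * x))) := by
    intro x
    rw [smul_eq_mul]
    ring
  simp_rw [this]
  rw [integral_const_mul, h, Real.rpow_add_one (by positivity), Real.rpow_natCast, one_div, inv_pow]
  field_simp

lemma memLp_two_id_expMeasure {r : ℝ} (hr : 0 < r) : MemLp id 2 (expMeasure r) := by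
  rw [memLp_two_iff_integrable_sq (by fun_prop)]
  -- The integral of a non-integrable function is `0` by convention, so a nonzero value proves
  -- integrability.
  refine Integrable.of_integral_ne_zero ?_
  simp only [id]
  rw [integral_pow_expMeasure hr 2]
  positivity

lemma integral_id_expMeasure {r : ℝ} (hr : 0 < r) : ∫ x, x ∂(expMeasure r) = 1 / r := by
  simpa using integral_pow_expMeasure hr 1

lemma variance_id_expMeasure {r : ℝ} (hr : 0 < r) : variance id (expMeasure r) = (1 / r) ^ 2 := by
  have := isProbabilityMeasure_expMeasure hr
  rw [variance_eq_sub (memLp_two_id_expMeasure hr)]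
  simp only [Pi.pow_apply, id]
  rw [integral_pow_expMeasure hr 2, integral_id_expMeasure hr]
  simp only [Nat.factorial]
  field_simp
  norm_num

lemma charFun_expMeasure {r : ℝ} (hr : 0 < r) (t : ℝ) :
    charFun (expMeasure r) t = r / (r - t * Complex.I) := by
  rw [charFun_apply_real, integral_expMeasure hr]
  have hre : (-(r - t * Complex.I)).re < 0 := by simpa using hr
  have : ∀ x : ℝ, (r * Real.exp (-(r * x))) • Complex.exp (t * x * Complex.I) =
      r * Complex.exp (-(r - t * Complex.I) * x) := by
    intro x
    rw [Complex.real_smul, Complex.ofReal_mul, Complex.ofReal_exp, mul_assoc, ← Complex.exp_add]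
    congr 2
    push_cast
    ring
  simp_rw [this]
  rw [integral_const_mul, integral_exp_mul_complex_Ioi hre]
  rw [Complex.ofReal_zero, mul_zero, Complex.exp_zero, neg_div_neg_eq, mul_one_div]

/-! ### Linear combinations of independent exponentials -/

section FiniteSum

variable {Ω ι : Type*} [MeasurableSpace Ω] {P : Measure Ω} [Fintype ι]
  {U : ι → Ω → ℝ} {r : ι → ℝ}

/-- Writing the factor `1 / (1 - iat)` as the exponential of a logarithm turns products over
independent terms into sums of exponents. -/
lemma charFun_map_centered_exponential {X : Ω → ℝ} {r : ℝ} (hr : 0 < r)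
    (hX : HasLaw X (expMeasure r) P) (a t : ℝ) :
    charFun (P.map fun ω => a * (r * X ω - 1)) t =
      Complex.exp (-(a * t * Complex.I) - Complex.log (1 + -(a * t * Complex.I))) := by
  have hmeas := hX.aemeasurable
  have hne : (1 : ℂ) + -(a * t * Complex.I) ≠ 0 := fun h => by
    simpa using congrArg Complex.re h
  have hr' : (r : ℂ) ≠ 0 := by exact_mod_cast hr.ne'
  rw [charFun_apply_real, integral_map (by fun_prop) (by fun_prop), Complex.exp_sub,
    Complex.exp_log hne]
  have h1 : ∀ ω, Complex.exp (t * ((a * (r * X ω - 1) : ℝ) : ℂ) * Complex.I) =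
      Complex.exp (-(a * t * Complex.I)) *
        Complex.exp (((t * a * r : ℝ) : ℂ) * (X ω) * Complex.I) := by
    intro ω
    rw [← Complex.exp_add]
    congr 1
    push_cast
    ring
  simp_rw [h1]
  rw [integral_const_mul, ← integral_map (f := fun x : ℝ =>
    Complex.exp (((t * a * r : ℝ) : ℂ) * x * Complex.I)) hmeas (by fun_prop), hX.map_eq,
    ← charFun_apply_real, charFun_expMeasure hr, div_eq_mul_inv]
  congr 1
  rw [show (r : ℂ) - ((t * a * r : ℝ) : ℂ) * Complex.I = r * (1 + -(a * t * Complex.I)) by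
    push_cast; ring, mul_inv, mul_inv_cancel_left₀ hr']

lemma memLp_two_of_hasLaw_expMeasure {X : Ω → ℝ} {r : ℝ} (hr : 0 < r)
    (hX : HasLaw X (expMeasure r) P) : MemLp X 2 P := by
  have := memLp_two_id_expMeasure hr
  rw [← hX.map_eq] at this
  exact this.comp_of_map hX.aemeasurable

lemma memLp_two_sum_exponential (hr : ∀ i, 0 < r i)
    (hU : ∀ i, HasLaw (U i) (expMeasure (r i)) P) (c : ι → ℝ) :
    MemLp (fun ω => ∑ i, c i * U i ω) 2 P :=
  memLp_finsetSum _ fun i _ => (memLp_two_of_hasLaw_expMeasure (hr i) (hU i)).const_mul _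

lemma integral_sum_exponential [IsProbabilityMeasure P] (hr : ∀ i, 0 < r i)
    (hU : ∀ i, HasLaw (U i) (expMeasure (r i)) P) (c : ι → ℝ) :
    ∫ ω, ∑ i, c i * U i ω ∂P = ∑ i, c i / r i := by
  rw [integral_finsetSum _ fun i _ =>
    ((memLp_two_of_hasLaw_expMeasure (hr i) (hU i)).integrable (by norm_num)).const_mul _]
  refine Finset.sum_congr rfl fun i _ => ?_
  rw [integral_const_mul, (hU i).integral_eq, integral_id_expMeasure (hr i), mul_one_div]

lemma variance_sum_exponential (hr : ∀ i, 0 < r i)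
    (hU : ∀ i, HasLaw (U i) (expMeasure (r i)) P) (hind : iIndepFun U P) (c : ι → ℝ) :
    variance (fun ω => ∑ i, c i * U i ω) P = ∑ i, (c i / r i) ^ 2 := by
  have h := IndepFun.variance_sum (μ := P) (X := fun i ω => c i * U i ω) (s := Finset.univ)
    (fun i _ => (memLp_two_of_hasLaw_expMeasure (hr i) (hU i)).const_mul _)
    (fun i _ j _ hij => (hind.indepFun hij).comp (measurable_const_mul (c i))
      (measurable_const_mul (c j)))
  rw [show (∑ i, fun ω => c i * U i ω) = fun ω => ∑ i, c i * U i ω by ext; simp] at h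
  rw [h]
  refine Finset.sum_congr rfl fun i _ => ?_
  rw [variance_const_mul, (hU i).variance_eq, variance_id_expMeasure (hr i)]
  ring

/-- The characteristic function of a standardized linear combination of independent exponential
variables. -/
lemma charFun_map_standardized_sum_exponential (hr : ∀ i, 0 < r i)
    (hU : ∀ i, HasLaw (U i) (expMeasure (r i)) P) (hind : iIndepFun U P) (c : ι → ℝ) (s t : ℝ) :
    charFun (P.map fun ω => ((∑ i, c i * U i ω) - ∑ i, c i / r i) / s) t =
      Complex.exp (∑ i, (-(((c i / r i / s : ℝ) : ℂ) * t * Complex.I) -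
        Complex.log (1 + -(((c i / r i / s : ℝ) : ℂ) * t * Complex.I)))) := by
  have h1 : (fun ω => ((∑ i, c i * U i ω) - ∑ i, c i / r i) / s) =
      fun ω => ∑ i, (c i / r i / s) * (r i * U i ω - 1) := by
    ext ω
    rw [← Finset.sum_sub_distrib, Finset.sum_div]
    refine Finset.sum_congr rfl fun i _ => ?_
    have := (hr i).ne'
    field_simp
  have hm := fun i => (hU i).aemeasurable
  rw [h1, iIndepFun.charFun_map_fun_sum_eq_prod
    (X := fun i ω => (c i / r i / s) * (r i * U i ω - 1)) (by fun_prop)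
    (hind.comp (fun i x => (c i / r i / s) * (r i * x - 1)) (by fun_prop)), Finset.prod_apply,
    Complex.exp_sum]
  exact Finset.prod_congr rfl fun i _ => charFun_map_centered_exponential (hr i) (hU i) _ _

end FiniteSum

/-! ### Central limit theorem -/

/-- Second order expansion of the logarithm of the characteristic function of a centered
exponential variable. -/
lemma norm_sub_log_one_add_add_sq_le {u : ℝ} (hu : |u| ≤ 1 / 2) :
    ‖-((u : ℂ) * Complex.I) - Complex.log (1 + -((u : ℂ) * Complex.I)) - (-(u ^ 2 / 2 : ℝ) : ℂ)‖ ≤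
      |u| ^ 3 := by
  have hz : ‖-((u : ℂ) * Complex.I)‖ = |u| := by simp
  have h := Complex.norm_log_sub_logTaylor_le 2 (z := -((u : ℂ) * Complex.I))
    (by rw [hz]; linarith)
  rw [hz] at h
  have hT : Complex.logTaylor (2 + 1) (-((u : ℂ) * Complex.I)) =
      -((u : ℂ) * Complex.I) + (u ^ 2 / 2 : ℝ) := by
    simp only [Complex.logTaylor_succ, Complex.logTaylor_zero, Pi.add_apply]
    push_cast
    ring_nf
    simp only [Complex.I_sq]
    ring
  rw [hT, norm_sub_rev] at h
  have h2 : (1 - |u|)⁻¹ ≤ 2 := by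
    rw [inv_le_comm₀ (by linarith) (by norm_num)]
    linarith
  calc _ = ‖-((u : ℂ) * Complex.I) + (u ^ 2 / 2 : ℝ) -
        Complex.log (1 + -((u : ℂ) * Complex.I))‖ := by congr 1; push_cast; ring
    _ ≤ _ := h
    _ ≤ |u| ^ 3 * 2 / ((2 : ℕ) + 1) := by gcongr
    _ ≤ |u| ^ 3 := by
      have : 0 ≤ |u| ^ 3 := by positivity
      norm_num
      linarith

/-- Uniform closeness of the characteristic exponent of a standardized linear combination of
exponential variables to that of the standard Gaussian law. -/
lemma norm_sum_exponent_add_le {ι : Type*} [Fintype ι] {a : ι → ℝ} (ha : ∑ i, a i ^ 2 = 1) {δ : ℝ}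
    (hδ : ∀ i, |a i| ≤ δ) {t : ℝ} (ht : δ * |t| ≤ 1 / 2) :
    ‖(∑ i, (-((a i : ℂ) * t * Complex.I) - Complex.log (1 + -((a i : ℂ) * t * Complex.I)))) -
      (-(t ^ 2 / 2 : ℝ) : ℂ)‖ ≤ δ * |t| ^ 3 := by
  have h1 : (-(t ^ 2 / 2 : ℝ) : ℂ) = ∑ i, (-((a i * t) ^ 2 / 2 : ℝ) : ℂ) := by
    rw [Finset.sum_neg_distrib, ← Complex.ofReal_sum]
    congr 2
    simp_rw [mul_pow]
    rw [← Finset.sum_div, ← Finset.sum_mul, ha, one_mul]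
  rw [h1, ← Finset.sum_sub_distrib]
  refine (norm_sum_le _ _).trans ?_
  -- Each cubic error satisfies `|a i| ^ 3 ≤ δ * a i ^ 2`, and the squares sum to `1`.
  calc _ ≤ ∑ i, δ * |t| ^ 3 * a i ^ 2 := by
        refine Finset.sum_le_sum fun i _ => ?_
        have hb : |a i * t| ≤ 1 / 2 := by
          rw [abs_mul]
          exact (mul_le_mul_of_nonneg_right (hδ i) (abs_nonneg t)).trans ht
        have h := norm_sub_log_one_add_add_sq_le hb
        rw [Complex.ofReal_mul] at h
        refine h.trans ?_
        rw [abs_mul, mul_pow, pow_succ |a i| 2, sq_abs]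
        have := mul_le_mul_of_nonneg_left (hδ i) (by positivity : 0 ≤ a i ^ 2 * |t| ^ 3)
        linarith
    _ = δ * |t| ^ 3 := by rw [← Finset.mul_sum, ha, mul_one]

/-- **Central limit theorem** for linear combinations of independent exponential variables: if the
largest standard deviation of a summand is negligible with respect to the standard deviation of the
sum, then the standardized sums converge to the standard Gaussian law. -/
theorem tendstoInDistribution_standardized_sum_exponential {Ω : ℕ → Type*}
    [∀ n, MeasurableSpace (Ω n)] {P : ∀ n, Measure (Ω n)} [∀ n, IsProbabilityMeasure (P n)]
    {ι : ℕ → Type*} [∀ n, Fintype (ι n)] {U : ∀ n, ι n → Ω n → ℝ} {r c : ∀ n, ι n → ℝ}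
    (hr : ∀ n i, 0 < r n i) (hU : ∀ n i, HasLaw (U n i) (expMeasure (r n i)) (P n))
    (hind : ∀ n, iIndepFun (U n) (P n)) {δ : ℕ → ℝ} (hδ : Tendsto δ atTop (𝓝 0))
    (hpos : ∀ᶠ n in atTop, 0 < ∑ i, (c n i / r n i) ^ 2)
    (hmax : ∀ᶠ n in atTop, ∀ i, |c n i / r n i| ≤ δ n * √(∑ i, (c n i / r n i) ^ 2)) :
    TendstoInDistribution
      (fun n ω => ((∑ i, c n i * U n i ω) - ∫ ω', ∑ i, c n i * U n i ω' ∂(P n)) /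
        √(variance (fun ω' => ∑ i, c n i * U n i ω') (P n)))
      atTop (id : ℝ → ℝ) P (gaussianReal 0 1) where
  forall_aemeasurable n := by
    have := fun i => (hU n i).aemeasurable
    fun_prop
  tendsto := by
    refine ProbabilityMeasure.tendsto_iff_tendsto_charFun.2 fun t => ?_
    simp only [ProbabilityMeasure.coe_mk, Measure.map_id, charFun_gaussianReal]
    simp_rw [fun n => integral_sum_exponential (hr n) (hU n) (c n),
      fun n => variance_sum_exponential (hr n) (hU n) (hind n) (c n),
      fun n => charFun_map_standardized_sum_exponential (hr n) (hU n) (hind n) (c n)]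
    refine (Complex.continuous_exp.tendsto _).comp ?_
    rw [show (t : ℂ) * ((0 : ℝ) : ℂ) * Complex.I - ((1 : NNReal) : ℂ) * (t : ℂ) ^ 2 / 2 =
      (-(t ^ 2 / 2 : ℝ) : ℂ) by push_cast; simp]
    rw [tendsto_iff_norm_sub_tendsto_zero]
    refine squeeze_zero' (Eventually.of_forall fun n => norm_nonneg _) ?_
      (g := fun n => δ n * |t| ^ 3) (by simpa using hδ.mul_const (|t| ^ 3))
    have hsmall : ∀ᶠ n in atTop, δ n * |t| ≤ 1 / 2 := by
      have : Tendsto (fun n => δ n * |t|) atTop (𝓝 0) := by simpa using hδ.mul_const |t|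
      exact this.eventually_le_const (by norm_num)
    filter_upwards [hpos, hmax, hsmall] with n h1 h2 h3
    refine norm_sum_exponent_add_le ?_ (fun i => ?_) h3
    · simp_rw [div_pow _ (√_)]
      rw [← Finset.sum_div, Real.sq_sqrt h1.le, div_self h1.ne']
    · rw [abs_div, abs_of_pos (Real.sqrt_pos.2 h1), div_le_iff₀ (Real.sqrt_pos.2 h1)]
      exact h2 i

/-! ### Bounds on the weights -/

/-- The ratio `p (-log p) ^ s / (1 - p)` is bounded on `(0, 1)` for `1 ≤ s`. -/
lemma mul_neg_log_rpow_div_le {s p : ℝ} (hs : 1 ≤ s) (hp0 : 0 < p) (hp1 : p < 1) :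
    p * (-Real.log p) ^ s / (1 - p) ≤ 2 ^ s + 2 * s ^ s := by
  have hL : 0 ≤ -Real.log p := neg_nonneg.2 (Real.log_nonpos hp0.le hp1.le)
  have h2 : (0 : ℝ) ≤ 2 ^ s := by positivity
  have hss : (0 : ℝ) ≤ s ^ s := by positivity
  have hq : 0 < 1 - p := by linarith
  rw [div_le_iff₀ hq]
  -- Near `1`, `-log p ≤ 2 (1 - p)`, and `s ≥ 1` lets one factor `1 - p` absorb the denominator.
  -- Near `0`, `log x ≤ x` at `x = p ^ (-1/s)` gives `p (-log p) ^ s ≤ s ^ s`.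
  rcases le_total (1 / 2) p with hp | hp
  · have hlog : -Real.log p ≤ 2 * (1 - p) := by
      have h := Real.one_sub_inv_le_log_of_pos hp0
      have hinv : p⁻¹ ≤ 2 := by
        rw [inv_le_comm₀ hp0 (by norm_num)]
        linarith
      have : p⁻¹ - 1 = p⁻¹ * (1 - p) := by field_simp
      nlinarith
    have h1 : (-Real.log p) ^ s ≤ 2 ^ s * (1 - p) := by
      calc (-Real.log p) ^ s ≤ (2 * (1 - p)) ^ s := by gcongr
        _ = 2 ^ s * (1 - p) ^ s := Real.mul_rpow (by norm_num) hq.le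
        _ ≤ 2 ^ s * (1 - p) := by
          gcongr
          simpa using Real.rpow_le_rpow_of_exponent_ge hq (by linarith) hs
    have h3 : p * (-Real.log p) ^ s ≤ (-Real.log p) ^ s :=
      mul_le_of_le_one_left (by positivity) hp1.le
    have h4 : 0 ≤ 2 * s ^ s * (1 - p) := by positivity
    linarith
  · have hs0 : 0 < s := by linarith
    have hlog : -Real.log p ≤ s * p ^ (-(1 / s)) := by
      have h := Real.log_le_self (Real.rpow_nonneg hp0.le (-(1 / s)))
      rw [Real.log_rpow hp0] at h
      have := mul_le_mul_of_nonneg_left h hs0.le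
      calc -Real.log p = s * (-(1 / s) * Real.log p) := by field_simp
        _ ≤ _ := this
    have h1 : p * (-Real.log p) ^ s ≤ s ^ s := by
      calc p * (-Real.log p) ^ s ≤ p * (s * p ^ (-(1 / s))) ^ s := by gcongr
        _ = p * (s ^ s * p ^ (-1 : ℝ)) := by
          rw [Real.mul_rpow hs0.le (by positivity), ← Real.rpow_mul hp0.le]
          congr 3
          field_simp
        _ = s ^ s := by
          rw [Real.rpow_neg_one]
          field_simp
    have h3 : 0 ≤ 2 ^ s * (1 - p) := by positivity
    nlinarith

lemma le_mul_neg_log_rpow_div {s p : ℝ} (hs : 0 ≤ s) (hp0 : 1 / 4 ≤ p) (hp1 : p ≤ 1 / 2) :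
    Real.log 2 ^ s / 4 ≤ p * (-Real.log p) ^ s / (1 - p) := by
  have hlog2 : 0 ≤ Real.log 2 := Real.log_nonneg (by norm_num)
  have hL : Real.log 2 ≤ -Real.log p := by
    rw [← Real.log_inv]
    refine Real.log_le_log (by norm_num) ?_
    rw [le_inv_comm₀ (by norm_num) (by linarith)]
    linarith
  have h1 : Real.log 2 ^ s ≤ (-Real.log p) ^ s := by gcongr
  have h2 : 0 ≤ Real.log 2 ^ s := by positivity
  rw [le_div_iff₀ (by linarith)]
  nlinarith

/-- The mean square of `p (-log p) ^ s / (1 - p)` over the points `i / n` is bounded below. -/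
lemma le_sum_sq_mul_neg_log_rpow_div {s : ℝ} (hs : 0 ≤ s) {n : ℕ} (hn : 8 ≤ n) :
    (n : ℝ) / 8 * (Real.log 2 ^ s / 4) ^ 2 ≤
      ∑ i : Fin (n - 1), ((((i : ℝ) + 1) / n) * (-Real.log (((i : ℝ) + 1) / n)) ^ s /
        (1 - ((i : ℝ) + 1) / n)) ^ 2 := by
  have hn0 : 0 < (n : ℝ) := by exact_mod_cast (by omega : 0 < n)
  rw [Fin.sum_univ_eq_sum_range (fun i : ℕ => ((((i : ℝ) + 1) / n) *
    (-Real.log (((i : ℝ) + 1) / n)) ^ s / (1 - ((i : ℝ) + 1) / n)) ^ 2) (n - 1)]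
  -- For these indices `(i + 1) / n` lies in `[1/4, 1/2]`, and there are at least `n / 8` of them.
  have hsub : Finset.Ico (n / 4) (2 * (n / 4)) ⊆ Finset.range (n - 1) := by
    intro i hi
    simp only [Finset.mem_Ico, Finset.mem_range] at hi ⊢
    omega
  refine le_trans ?_ (Finset.sum_le_sum_of_subset_of_nonneg hsub fun i _ _ => sq_nonneg _)
  have hcard : (n : ℝ) / 8 ≤ (Finset.Ico (n / 4) (2 * (n / 4))).card := by
    rw [Nat.card_Ico, div_le_iff₀ (by norm_num)]
    exact_mod_cast (by omega : n ≤ (2 * (n / 4) - n / 4) * 8)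
  refine (mul_le_mul_of_nonneg_right hcard (sq_nonneg _)).trans ?_
  rw [← nsmul_eq_mul]
  refine Finset.card_nsmul_le_sum _ _ _ fun i hi => ?_
  rw [Finset.mem_Ico] at hi
  have hlog2 : 0 ≤ Real.log 2 := Real.log_nonneg (by norm_num)
  refine pow_le_pow_left₀ (by positivity) (le_mul_neg_log_rpow_div hs ?_ ?_) 2
  · rw [div_le_div_iff₀ (by norm_num) hn0]
    exact_mod_cast (by omega : 1 * n ≤ (i + 1) * 4)
  · rw [div_le_div_iff₀ hn0 (by norm_num)]
    exact_mod_cast (by omega : (i + 1) * 2 ≤ 1 * n)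

/-! ### Assembly -/

theorem theorem4p2 {α θ : ℝ} (hα₀ : 0 < α) (hα₁ : α < 1) (hθ : 0 < θ)
    {Ω : ℕ → Type*} [∀ n, MeasurableSpace (Ω n)]
    (P : ∀ n, Measure (Ω n)) [∀ n, IsProbabilityMeasure (P n)]
    -- for every `n`, a random sample of size `n` from the exponential law with mean `θ`
    (X : ∀ n, Fin n → Ω n → ℝ)
    (hindep : ∀ n, iIndepFun (X n) (P n))
    (hlaw : ∀ n i, HasLaw (X n i) (expMeasure θ⁻¹) (P n)) :
    -- the spacings are independent, and `U_i` is exponential with rate `(n - i) / θ`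
    (∀ n, iIndepFun (fun i ω => spacing (fun j => X n j ω) i) (P n)) ∧
    (∀ n (i : Fin (n - 1)), HasLaw (fun ω => spacing (fun j => X n j ω) i)
      (expMeasure (((n : ℝ) - ((i : ℝ) + 1)) / θ)) (P n)) ∧
    -- the empirical EFCPE is a weighted sum of the spacings
    (∀ n, ∀ᵐ ω ∂(P n), empEFCPE α (fun j => X n j ω) =
      Real.Gamma (1 + α) ^ (1 / α) * ∑ i : Fin (n - 1), spacing (fun j => X n j ω) i *
        ((((i : ℝ) + 1) / n) * (-Real.log (((i : ℝ) + 1) / n)) ^ (1 / α))) ∧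
    -- it has a finite second moment and, for `n ≥ 2`, a positive variance
    (∀ n, MemLp (fun ω => empEFCPE α (fun j => X n j ω)) 2 (P n)) ∧
    (∀ n, 2 ≤ n → 0 < variance (fun ω => empEFCPE α (fun j => X n j ω)) (P n)) ∧
    -- the central limit theorem
    TendstoInDistribution
      (fun n ω =>
        (empEFCPE α (fun j => X n j ω) - ∫ ω', empEFCPE α (fun j => X n j ω') ∂(P n)) /
          √(variance (fun ω' => empEFCPE α (fun j => X n j ω')) (P n)))
      atTop (id : ℝ → ℝ) P (gaussianReal 0 1) := by
  -- This is where `α < 1` enters: it keeps the weights bounded as `p` tends to `1`.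
  have hs : 1 ≤ 1 / α := by
    rw [le_div_iff₀ hα₀]
    linarith
  have hind := fun n => iIndepFun_spacing hθ (hindep n) (hlaw n)
  have hU := fun n => hasLaw_spacing hθ (hindep n) (hlaw n)
  have hrep : ∀ n, ∀ᵐ ω ∂(P n), empEFCPE α (fun j => X n j ω) =
      Real.Gamma (1 + α) ^ (1 / α) * ∑ i : Fin (n - 1), spacing (fun j => X n j ω) i *
        ((((i : ℝ) + 1) / n) * (-Real.log (((i : ℝ) + 1) / n)) ^ (1 / α)) := by
    intro n
    filter_upwards [ae_all_iff.2 fun i => ae_nonneg_of_hasLaw_expMeasure (hlaw n i)] with ω hω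
    exact empEFCPE_eq_sum_spacing hα₀ _ hω
  set K : ℝ := Real.Gamma (1 + α) ^ (1 / α) with hK
  have hKpos : 0 < K := Real.rpow_pos_of_pos (Real.Gamma_pos_of_pos (by linarith)) _
  set r : ∀ n : ℕ, Fin (n - 1) → ℝ := fun n i => ((n : ℝ) - ((i : ℝ) + 1)) / θ with hr_def
  set c : ∀ n : ℕ, Fin (n - 1) → ℝ := fun n i =>
    K * ((((i : ℝ) + 1) / n) * (-Real.log (((i : ℝ) + 1) / n)) ^ (1 / α)) with hc_def
  have hlt : ∀ (n : ℕ) (i : Fin (n - 1)), (i : ℝ) + 1 < n := fun n i => by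
    exact_mod_cast (by omega : (i : ℕ) + 1 < n)
  have hn0 : ∀ (n : ℕ) (_ : Fin (n - 1)), 0 < (n : ℝ) := fun n i => by
    have := hlt n i
    have : (0 : ℝ) ≤ i := Nat.cast_nonneg _
    linarith
  have hp1 : ∀ (n : ℕ) (i : Fin (n - 1)), ((i : ℝ) + 1) / n < 1 := fun n i =>
    (div_lt_one (hn0 n i)).2 (hlt n i)
  have hp0 : ∀ (n : ℕ) (i : Fin (n - 1)), 0 < ((i : ℝ) + 1) / n := fun n i => by
    have := hn0 n i
    positivity
  have hr : ∀ n i, 0 < r n i := fun n i => div_pos (sub_pos.2 (hlt n i)) hθ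
  have hsum : ∀ n, (fun ω => empEFCPE α (fun j => X n j ω)) =ᵐ[P n]
      fun ω => ∑ i, c n i * spacing (fun j => X n j ω) i := by
    intro n
    filter_upwards [hrep n] with ω hω
    rw [hω, Finset.mul_sum]
    exact Finset.sum_congr rfl fun i _ => by simp only [hc_def]; ring
  have hratio : ∀ n i, c n i / r n i = K * θ / n *
      ((((i : ℝ) + 1) / n) * (-Real.log (((i : ℝ) + 1) / n)) ^ (1 / α) /
        (1 - ((i : ℝ) + 1) / n)) := by
    intro n i
    have h1 := hn0 n i
    have h2 : (n : ℝ) - ((i : ℝ) + 1) ≠ 0 := (sub_pos.2 (hlt n i)).ne'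
    have h3 : 1 - ((i : ℝ) + 1) / n = (n - ((i : ℝ) + 1)) / n := by field_simp
    simp only [hc_def, hr_def]
    rw [h3]
    generalize (-Real.log (((i : ℝ) + 1) / n)) ^ (1 / α) = L
    field_simp
  have hratio_pos : ∀ n i, 0 < c n i / r n i := by
    intro n i
    refine div_pos (mul_pos hKpos (mul_pos (hp0 n i) (Real.rpow_pos_of_pos ?_ _))) (hr n i)
    exact neg_pos.2 (Real.log_neg (hp0 n i) (hp1 n i))
  have hvar_pos : ∀ n, 2 ≤ n → 0 < ∑ i, (c n i / r n i) ^ 2 := fun n hn =>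
    Finset.sum_pos (fun i _ => pow_pos (hratio_pos n i) 2)
      ⟨⟨0, by omega⟩, Finset.mem_univ _⟩
  refine ⟨hind, hU, hrep, fun n => ?_, fun n hn => ?_, ?_⟩
  · exact (memLp_two_sum_exponential (hr n) (hU n) (c n)).ae_eq (hsum n).symm
  · rw [variance_congr (hsum n), variance_sum_exponential (hr n) (hU n) (hind n)]
    exact hvar_pos n hn
  · set C : ℝ := 2 ^ (1 / α) + 2 * (1 / α) ^ (1 / α) with hC
    set d : ℝ := Real.log 2 ^ (1 / α) / 4 with hd
    have hdpos : 0 < d := by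
      have := Real.log_pos (by norm_num : (1 : ℝ) < 2)
      positivity
    have hCpos : 0 < C := by positivity
    -- `C` bounds `φ` above and `d` bounds it below on `[1/4, 1/2]`, so the total standard deviation
    -- is at least `K θ / n * d * √(n / 8)`; the factor `K θ / n` cancels in the ratio.
    have hδ : Tendsto (fun n : ℕ => C / (d * √((n : ℝ) / 8))) atTop (𝓝 0) := by
      refine Tendsto.div_atTop tendsto_const_nhds (Tendsto.const_mul_atTop hdpos ?_)
      exact Real.tendsto_sqrt_atTop.comp
        (tendsto_natCast_atTop_atTop.atTop_div_const (by norm_num))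
    have hclt := tendstoInDistribution_standardized_sum_exponential hr hU hind (c := c) hδ
      (eventually_atTop.2 ⟨2, hvar_pos⟩) (eventually_atTop.2 ⟨8, fun n hn i => ?_⟩)
    · refine hclt.congr (fun n => ?_) (ae_eq_refl _)
      filter_upwards [hsum n] with ω hω
      rw [hω, integral_congr_ae (hsum n), variance_congr (hsum n)]
    · have hn' : 0 < (n : ℝ) := hn0 n i
      have hKn : 0 < K * θ / n := by positivity
      have hsqrt : K * θ / n * (d * √((n : ℝ) / 8)) ≤ √(∑ i, (c n i / r n i) ^ 2) := by
        refine Real.le_sqrt_of_sq_le ?_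
        simp_rw [hratio, mul_pow]
        rw [← Finset.mul_sum, Real.sq_sqrt (by positivity)]
        have := le_sum_sq_mul_neg_log_rpow_div (s := 1 / α) (by linarith) hn
        exact mul_le_mul_of_nonneg_left ((mul_comm _ _).trans_le this) (by positivity)
      rw [abs_of_pos (hratio_pos n i)]
      calc c n i / r n i ≤ K * θ / n * C := by
            rw [hratio]
            exact mul_le_mul_of_nonneg_left (mul_neg_log_rpow_div_le hs (hp0 n i) (hp1 n i)) hKn.le
        _ = C / (d * √((n : ℝ) / 8)) * (K * θ / n * (d * √((n : ℝ) / 8))) := by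
            have : 0 < √((n : ℝ) / 8) := Real.sqrt_pos.2 (by positivity)
            field_simp
        _ ≤ _ := mul_le_mul_of_nonneg_left hsqrt (by positivity)
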